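/- Let $\gamma$ be an atomless Borel probability measure on a standard Borel space $X$, and let ${\rm Aut}(\gamma)$ be the group of measure equivalence classes of measurable measure preserving bijections of $X$, with composition and the weak topology (the coarsest topology for which, for each measurable $A\subseteq X$, the map $T\mapsto T(A)$ is continuous into the measure algebra of $\gamma$ with the metric $d(A,B)=\gamma(A\triangle B)$). Let $\lambda$ be the product measure on $\{0,1\}^{\mathbb N}$ of the uniform measures on $\{0,1\}$, and let $L^0(\lambda,\mathbb T)$ be the group of $\lambda$-classes of measurable functions from $\{0,1\}^{\mathbb N}$ to the unit circle $\mathbb T\subseteq\mathbb C$, with pointwise multiplication and the topology of convergence in measure. A boolean action of $L^0(\lambda,\mathbb T)$ on $(X,\gamma)$ is a continuous homomorphism $\zeta\colon L^0(\lambda,\mathbb T)\to{\rm Aut}(\gamma)$. It is ergodic if each measurable $B\subseteq X$ with $\gamma(\zeta(g)(B)\triangle B)=0$ for all $g\in L^0(\lambda,\mathbb T)$ has $\gamma(B)\in\{0,1\}$. A near-action realizing $\zeta$ is a Borel map $(g,\omega)\mapsto g\omega$ from $L^0(\lambda,\mathbb T)\times X$ to $X$ such that $1\omega=\omega$ for almost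 every $\omega$; for all $g,h$, $g(h\omega)=(gh)\omega$ for almost every $\omega$; for every $g$ the map $\omega\mapsto g\omega$ preserves $\gamma$; and for every $g$ the class of $\omega\mapsto g\omega$ is $\zeta(g)$. For $n\ge 0$ let $\mathbb S_n\cong\mathbb T^{2^n}$ be the subgroup of $L^0(\lambda,\mathbb T)$ of all step functions $\sum_{s\in\{0,1\}^n} z_s\chi_{[s]}$, $z_s\in\mathbb T$, where $[s]=\{\alpha\in\{0,1\}^{\mathbb N} : \alpha\upharpoonright n=s\}$, and let $\theta$ be its Haar probability measure. **Theorem 1.2.** Let $\zeta$ be a boolean action of $L^0(\lambda,\mathbb T)$ on $(X,\gamma)$. There is a near-action realizing $\zeta$. For each near-action realizing $\zeta$ and each square integrable $f\colon X\to\mathbb C$, put $$(A_nf)(\omega)=\int_{\mathbb S_n} f(t\omega)\,d\theta(t).$$ 1. For each $n$, the function $t\mapsto f(t\omega)$ is $\theta$-integrable for almost every $\omega$, $A_nf\in L^2(\gamma)$, and $\|A_nf\|_2\le\|f\|_2$. 2. If $\zeta$ is ergodic, then $(A_nf)_n$ converges in norm in $L^2(\gamma)$ to the function constantly equal to $\int_X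 f\,d\gamma$. -/

import Mathlib

open MeasureTheory Filter Set
open scoped Topology ENNReal

/-! ### The group of automorphisms of a measure space -/

/-- The group (under composition) of all bijections `e` of `X` such that `e`, `e⁻¹` are measurable
and `e` preserves the measure `γ`. -/
def MPGroup {X : Type*} [MeasurableSpace X] (γ : Measure X) : Subgroup (Equiv.Perm X) where
  carrier := {e | MeasurePreserving (e : X → X) γ γ ∧ Measurable (e⁻¹ : Equiv.Perm X)}
  mul_mem' := by
    rintro a b ⟨ha, ha'⟩ ⟨hb, hb'⟩
    refine ⟨ha.comp hb, ?_⟩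
    rw [mul_inv_rev]
    exact hb'.comp ha'
  one_mem' := ⟨MeasurePreserving.id γ, by rw [inv_one]; exact measurable_id⟩
  inv_mem' := by
    rintro a ⟨ha, ha'⟩
    refine ⟨⟨ha', ?_⟩, by rw [inv_inv]; exact ha.measurable⟩
    conv_lhs => rw [← ha.map_eq]
    rw [Measure.map_map ha' ha.measurable]
    have h : ((a⁻¹ : Equiv.Perm X) : X → X) ∘ a = id := by
      funext x; simp
    rw [h, Measure.map_id]

/-- The elements of `MPGroup γ` that are equal to the identity almost everywhere. -/
def aeTrivial {X : Type*} [MeasurableSpace X] (γ : Measure X) : Subgroup (MPGroup γ) where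
  carrier := {e | ∀ᵐ x ∂γ, e.1 x = x}
  mul_mem' := by
    intro a b ha hb
    have ha' : ∀ᵐ x ∂γ, a.1 x = x := ha
    have hb' : ∀ᵐ x ∂γ, b.1 x = x := hb
    show ∀ᵐ x ∂γ, (a.1 * b.1) x = x
    filter_upwards [ha', hb'] with x h1 h2
    rw [Equiv.Perm.mul_apply, h2, h1]
  one_mem' := by
    show ∀ᵐ x ∂γ, (1 : Equiv.Perm X) x = x
    exact Eventually.of_forall fun _ => rfl
  inv_mem' := by
    intro a ha
    have ha' : ∀ᵐ x ∂γ, a.1 x = x := ha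
    show ∀ᵐ x ∂γ, (a.1⁻¹) x = x
    filter_upwards [ha'] with x h1
    rw [Equiv.Perm.inv_eq_iff_eq, h1]

instance aeTrivial_normal {X : Type*} [MeasurableSpace X] (γ : Measure X) :
    (aeTrivial γ).Normal where
  conj_mem := by
    intro a ha g
    have ha' : ∀ᵐ x ∂γ, a.1 x = x := ha
    show ∀ᵐ x ∂γ, (g.1 * a.1 * g.1⁻¹) x = x
    have hg : MeasurePreserving ((g⁻¹ : MPGroup γ).1 : X → X) γ γ := (g⁻¹).2.1
    filter_upwards [hg.quasiMeasurePreserving.ae ha'] with x hx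
    have hx' : a.1 (g.1⁻¹ x) = g.1⁻¹ x := hx
    rw [Equiv.Perm.mul_apply, Equiv.Perm.mul_apply, hx']
    simp

/-- `Aut(γ)`: measure equivalence classes of measurable measure preserving bijections. -/
def AutGroup {X : Type*} [MeasurableSpace X] (γ : Measure X) : Type _ :=
  MPGroup γ ⧸ aeTrivial γ

instance {X : Type*} [MeasurableSpace X] (γ : Measure X) : Group (AutGroup γ) :=
  inferInstanceAs (Group (MPGroup γ ⧸ aeTrivial γ))

/-- A representative of the class `T ∈ Aut(γ)`. All notions below depend only on `T`, since any
two representatives agree almost everywhere. -/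
noncomputable def AutGroup.rep {X : Type*} [MeasurableSpace X] {γ : Measure X}
    (T : AutGroup γ) : MPGroup γ :=
  Quotient.out T

/-- The image `T(A)` of a measurable set `A` under `T ∈ Aut(γ)` (well defined modulo null sets). -/
noncomputable def AutGroup.image {X : Type*} [MeasurableSpace X] {γ : Measure X}
    (T : AutGroup γ) (A : MeasuredSets γ) : MeasuredSets γ :=
  ⟨T.rep.1 '' (A : Set X), by
    rw [Equiv.image_eq_preimage_symm]
    exact T.rep.2.2 A.2⟩

/-- The weak topology on `Aut(γ)`: the coarsest one such that, for every measurable set `A`, the map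
`T ↦ T(A)` is continuous into the measure algebra with the metric `d(A, B) = γ(A ∆ B)`. -/
noncomputable instance {X : Type*} [MeasurableSpace X] (γ : Measure X) :
    TopologicalSpace (AutGroup γ) :=
  ⨅ A : MeasuredSets γ,
    TopologicalSpace.induced (fun T : AutGroup γ => T.image A) inferInstance

/-! ### Boolean actions and near-actions -/

/-- A boolean action of `G` on `(X, γ)`: a continuous homomorphism `G → Aut(γ)`. -/
abbrev BooleanAction (G : Type*) [Group G] [TopologicalSpace G]
    {X : Type*} [MeasurableSpace X] (γ : Measure X) : Type _ :=
  G →ₜ* AutGroup γ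

/-- A boolean action is ergodic if each measurable set that is invariant modulo null sets under
every `g ∈ G` has measure `0` or `1`. -/
def BooleanAction.IsErgodic {G : Type*} [Group G] [TopologicalSpace G]
    {X : Type*} [MeasurableSpace X] {γ : Measure X} (ζ : BooleanAction G γ) : Prop :=
  ∀ B : MeasuredSets γ, (∀ g : G, ((ζ g).image B : Set X) =ᵐ[γ] (B : Set X)) →
    γ (B : Set X) = 1 ∨ γ (B : Set X) = 0

/-- A near-action of `G` on `(X, γ)`, where `a g ω` stands for `gω` and `G` carries its Borel
`σ`-algebra. -/
structure IsNearAction {G : Type*} [Group G] [TopologicalSpace G]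
    {X : Type*} [MeasurableSpace X] (γ : Measure X) (a : G → X → X) : Prop where
  measurable : Measurable[(borel G).prod inferInstance] (fun p : G × X => a p.1 p.2)
  one_ae : ∀ᵐ ω ∂γ, a 1 ω = ω
  mul_ae : ∀ g h : G, ∀ᵐ ω ∂γ, a g (a h ω) = a (g * h) ω
  measurePreserving : ∀ g : G, MeasurePreserving (a g) γ γ

/-- The near-action `a` realizes (induces) the boolean action `ζ`: for every `g`, the class of the
map `ω ↦ a g ω` is `ζ g`. -/
def BooleanAction.IsRealizedBy {G : Type*} [Group G] [TopologicalSpace G]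
    {X : Type*} [MeasurableSpace X] {γ : Measure X} (ζ : BooleanAction G γ)
    (a : G → X → X) : Prop :=
  IsNearAction γ a ∧ ∀ g : G, a g =ᵐ[γ] ((ζ g).rep.1 : X → X)

/-! ### The group `L⁰(λ, 𝕋)` -/

/-- The product measure on `{0,1}^ℕ` of the uniform measures on `{0,1}`. -/
noncomputable def cantorMeasure : Measure (ℕ → Bool) :=
  Measure.infinitePi fun _ : ℕ => (PMF.uniformOfFintype Bool).toMeasure

/-- Equivalence classes of measurable functions from `{0,1}^ℕ` to the circle `𝕋`. -/
def LZero : Type :=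
  (ℕ → Bool) →ₘ[cantorMeasure] Circle

noncomputable instance : CommGroup LZero :=
  inferInstanceAs (CommGroup ((ℕ → Bool) →ₘ[cantorMeasure] Circle))

/-- The class of a (strongly) measurable function. -/
noncomputable def LZero.mk (f : (ℕ → Bool) → Circle) (hf : AEStronglyMeasurable f cantorMeasure) :
    LZero :=
  AEEqFun.mk f hf

/-- A representative of an element of `L⁰(λ, 𝕋)`. -/
noncomputable def LZero.toFun (φ : LZero) : (ℕ → Bool) → Circle :=
  AEEqFun.cast φ

/-- The topology of convergence in measure: the sets
`{ψ | λ {α | ε ≤ dist (φ α) (ψ α)} ≤ ε}`, `ε > 0`, form a basis of neighbourhoods of `φ`. -/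
instance : TopologicalSpace LZero where
  IsOpen U := ∀ φ ∈ U, ∃ ε : ℝ, 0 < ε ∧ ∀ ψ : LZero,
    cantorMeasure {α | ε ≤ dist (φ.toFun α) (ψ.toFun α)} ≤ ENNReal.ofReal ε → ψ ∈ U
  isOpen_univ := fun _ _ => ⟨1, one_pos, fun _ _ => mem_univ _⟩
  isOpen_inter := by
    rintro U V hU hV φ ⟨hφU, hφV⟩
    obtain ⟨ε, hε, h⟩ := hU φ hφU
    obtain ⟨δ, hδ, h'⟩ := hV φ hφV
    refine ⟨min ε δ, lt_min hε hδ, fun ψ hψ => ⟨h ψ ?_, h' ψ ?_⟩⟩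
    · refine (measure_mono fun α hα => ?_).trans
        (hψ.trans (ENNReal.ofReal_le_ofReal (min_le_left _ _)))
      exact (min_le_left ε δ).trans (show _ ≤ _ from hα)
    · refine (measure_mono fun α hα => ?_).trans
        (hψ.trans (ENNReal.ofReal_le_ofReal (min_le_right _ _)))
      exact (min_le_right ε δ).trans (show _ ≤ _ from hα)
  isOpen_sUnion := by
    intro S hS φ hφ
    obtain ⟨U, hU, hφU⟩ := hφ
    obtain ⟨ε, hε, h⟩ := hS U hU φ hφU
    exact ⟨ε, hε, fun ψ hψ => ⟨U, hU, h ψ hψ⟩⟩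

instance : MeasurableSpace LZero := borel LZero
instance : BorelSpace LZero := ⟨rfl⟩

noncomputable instance : MeasurableSpace Circle := borel Circle
instance : BorelSpace Circle := ⟨rfl⟩

/-! ### The subgroups `𝕊ₙ` and their Haar measures -/

/-- The step function `∑ₛ z_s χ_[s]`, with `s` ranging over `{0,1}ⁿ` and
`[s] = {α | α ↾ n = s}`. -/
def stepFun (n : ℕ) (z : (Fin n → Bool) → Circle) : (ℕ → Bool) → Circle :=
  fun α => z fun i => α i

theorem stepFun_measurable (n : ℕ) (z : (Fin n → Bool) → Circle) :
    AEStronglyMeasurable (stepFun n z) cantorMeasure :=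
  ((measurable_of_finite z).comp
    (measurable_pi_lambda _ fun i : Fin n => measurable_pi_apply (i : ℕ))).aestronglyMeasurable

/-- The homomorphism `𝕋^(2ⁿ) → L⁰(λ, 𝕋)`, `(z_s) ↦ ∑ₛ z_s χ_[s]`. -/
noncomputable def stepHom (n : ℕ) : ((Fin n → Bool) → Circle) →* LZero where
  toFun z := LZero.mk (stepFun n z) (stepFun_measurable n z)
  map_one' := rfl
  map_mul' z w :=
    (AEEqFun.mk_mul_mk (stepFun n z) (stepFun n w) (stepFun_measurable n z)
      (stepFun_measurable n w)).symm

/-- The subgroup `𝕊ₙ` of `L⁰(λ, 𝕋)` of all step functions constant on each `[s]`, `s ∈ {0,1}ⁿ`. -/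
noncomputable def stepGroup (n : ℕ) : Subgroup LZero :=
  (stepHom n).range

theorem stepHom_continuous (n : ℕ) : Continuous (stepHom n) := by
  rw [continuous_def]
  intro U hU
  rw [isOpen_iff_mem_nhds]
  intro z hz
  obtain ⟨ε, hε, h⟩ := hU (stepHom n z) hz
  have hs : ∀ s : Fin n → Bool, ∀ᶠ w : (Fin n → Bool) → Circle in 𝓝 z, dist (z s) (w s) < ε := by
    intro s
    have hc : Continuous fun w : (Fin n → Bool) → Circle => dist (z s) (w s) := by fun_prop
    exact hc.continuousAt.eventually_lt_const (by simpa using hε)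
  filter_upwards [eventually_all.2 hs] with w hw
  refine h _ ?_
  have h0 : cantorMeasure {α | ε ≤ dist ((stepHom n z).toFun α) ((stepHom n w).toFun α)} = 0 := by
    have h1 : ∀ᵐ α ∂cantorMeasure, (stepHom n z).toFun α = stepFun n z α :=
      AEEqFun.coeFn_mk _ (stepFun_measurable n z)
    have h2 : ∀ᵐ α ∂cantorMeasure, (stepHom n w).toFun α = stepFun n w α :=
      AEEqFun.coeFn_mk _ (stepFun_measurable n w)
    have h3 : ∀ᵐ α ∂cantorMeasure,
        ¬ ε ≤ dist ((stepHom n z).toFun α) ((stepHom n w).toFun α) := by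
      filter_upwards [h1, h2] with α e1 e2
      rw [e1, e2, not_le]
      exact hw _
    simpa [ae_iff] using h3
  rw [h0]
  exact bot_le

/-- The isomorphism `𝕋^(2ⁿ) → 𝕊ₙ`, `(z_s) ↦ ∑ₛ z_s χ_[s]`. -/
noncomputable def toStepGroup (n : ℕ) (z : (Fin n → Bool) → Circle) : stepGroup n :=
  ⟨stepHom n z, z, rfl⟩

theorem toStepGroup_measurable (n : ℕ) : Measurable (toStepGroup n) :=
  (stepHom_continuous n).measurable.subtype_mk

/-- The Haar probability measure `θ` on `𝕊ₙ` (with the Borel `σ`-algebra inherited from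
`L⁰(λ, 𝕋)`): the image of the Haar probability measure of the compact group `𝕋^(2ⁿ)` under the
isomorphism `(z_s) ↦ ∑ₛ z_s χ_[s]`. -/
noncomputable def stepHaar (n : ℕ) : Measure (stepGroup n) :=
  (Measure.haarMeasure (⊤ : TopologicalSpace.PositiveCompacts ((Fin n → Bool) → Circle))).map
    (toStepGroup n)

instance (n : ℕ) : IsProbabilityMeasure (stepHaar n) := by
  refine ⟨?_⟩
  rw [stepHaar, Measure.map_apply (toStepGroup_measurable n) MeasurableSet.univ,
    preimage_univ]
  exact Measure.haarMeasure_self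

/-! ### The averaging operators -/

/-- `(Aₙ f)(ω) = ∫_{𝕊ₙ} f(tω) dθ(t)`, with `tω` computed from the near-action `a`. -/
noncomputable def averaging {X : Type*} (a : LZero → X → X) (n : ℕ) (f : X → ℂ) (ω : X) : ℂ :=
  ∫ t : stepGroup n, f (a (t : LZero) ω) ∂(stepHaar n)

/-! A jointly measurable version of `ζ` comes from disintegration. Continuity of `ζ` makes the graph
measures of the maps `ζ g` into a kernel; its conditional measures over the first coordinate are
almost surely Dirac, and their atoms define the near-action
(`BooleanAction.exists_measurable_version`). The bounds on averages hold because `(ω, t) ↦ tω`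
carries `γ × θ` to `γ`, so Fubini applies, and `θ` has mass one. For convergence, `Aₙ` is the
orthogonal projection of `L²(γ)` onto the `𝕊ₙ`-fixed functions
(`starProjection_fixedSubmodule_range`). These subspaces decrease, so `Aₙ f` converges to the
projection of `f` on their intersection (`tendsto_starProjection_iInf`). A function there is
invariant under `⋃ₙ 𝕊ₙ`, which is dense in `L⁰(λ, 𝕋)` (`dense_iUnion_stepGroup`). The stabilizer of
a class of sets is closed in the group, so ergodicity makes the function constant; pairing with `1`
identifies the constant. -/

open ProbabilityTheory

/-! ### Averages over a probability space of measure preserving maps -/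

section Averages

variable {T X : Type*} [MeasurableSpace T] [MeasurableSpace X] {θ : Measure T}
  [IsProbabilityMeasure θ] {γ : Measure X} [IsProbabilityMeasure γ] {b : T → X → X}

/-- The skew product `(t, ω) ↦ (t, b t ω)` preserves `θ × γ` because each fibre map preserves `γ`.
-/
theorem measurePreserving_uncurry_prod (hb : Measurable fun p : T × X => b p.1 p.2)
    (hp : ∀ t, MeasurePreserving (b t) γ γ) :
    MeasurePreserving (fun p : X × T => b p.2 p.1) (γ.prod θ) γ := by
  have h1 : MeasurePreserving (fun p : T × X => (p.1, b p.1 p.2)) (θ.prod γ) (θ.prod γ) :=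
    (MeasurePreserving.id θ).skew_product hb (Eventually.of_forall fun t => (hp t).map_eq)
  exact (measurePreserving_snd.comp h1).comp Measure.measurePreserving_swap

theorem ae_ae_comp_of_ae (hb : Measurable fun p : T × X => b p.1 p.2)
    (hp : ∀ t, MeasurePreserving (b t) γ γ) {P : X → Prop} (h : ∀ᵐ ω ∂γ, P ω) :
    ∀ᵐ ω ∂γ, ∀ᵐ t ∂θ, P (b t ω) :=
  Measure.ae_ae_of_ae_prod
    ((measurePreserving_uncurry_prod hb hp).quasiMeasurePreserving.ae h)

theorem integral_comp_congr_ae (hb : Measurable fun p : T × X => b p.1 p.2)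
    (hp : ∀ t, MeasurePreserving (b t) γ γ) {f g : X → ℂ} (h : f =ᵐ[γ] g) :
    (fun ω => ∫ t, f (b t ω) ∂θ) =ᵐ[γ] fun ω => ∫ t, g (b t ω) ∂θ := by
  filter_upwards [ae_ae_comp_of_ae (θ := θ) hb hp h] with ω hω
  exact integral_congr_ae hω

theorem ae_integrable_comp (hb : Measurable fun p : T × X => b p.1 p.2)
    (hp : ∀ t, MeasurePreserving (b t) γ γ) {f : X → ℂ} (hf : Integrable f γ) :
    ∀ᵐ ω ∂γ, Integrable (fun t => f (b t ω)) θ :=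
  ((measurePreserving_uncurry_prod hb hp).integrable_comp_of_integrable hf).prod_right_ae

theorem aestronglyMeasurable_integral_comp (hb : Measurable fun p : T × X => b p.1 p.2)
    (hp : ∀ t, MeasurePreserving (b t) γ γ) {f : X → ℂ} (hf : AEStronglyMeasurable f γ) :
    AEStronglyMeasurable (fun ω => ∫ t, f (b t ω) ∂θ) γ :=
  (hf.comp_measurePreserving (measurePreserving_uncurry_prod hb hp)).integral_prod_right'

theorem eLpNorm_two_sq {Y : Type*} [MeasurableSpace Y] (μ : Measure Y) (f : Y → ℂ) :
    eLpNorm f 2 μ ^ 2 = ∫⁻ y, ‖f y‖ₑ ^ 2 ∂μ := by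
  have h := eLpNorm_nnreal_pow_eq_lintegral (f := f) (μ := μ) (p := 2) two_ne_zero
  simp only [NNReal.coe_ofNat, ENNReal.coe_ofNat, ENNReal.rpow_ofNat] at h
  exact h

/-- For fixed `ω` the `L¹(θ)` norm is at most the `L²(θ)` norm; Tonelli then gives the norm of `f (b
t ω)` on `γ × θ`, which is that of `f`. -/
theorem eLpNorm_integral_comp_le (hb : Measurable fun p : T × X => b p.1 p.2)
    (hp : ∀ t, MeasurePreserving (b t) γ γ) {f : X → ℂ} (hf : AEStronglyMeasurable f γ) :
    eLpNorm (fun ω => ∫ t, f (b t ω) ∂θ) 2 γ ≤ eLpNorm f 2 γ := by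
  have hm := measurePreserving_uncurry_prod (θ := θ) hb hp
  have hfm := hf.comp_measurePreserving hm
  rw [← ENNReal.pow_le_pow_left_iff two_ne_zero, eLpNorm_two_sq,
    ← eLpNorm_comp_measurePreserving hf hm, eLpNorm_two_sq,
    lintegral_prod _ (hfm.enorm.pow_const 2)]
  refine lintegral_mono_ae ?_
  filter_upwards [hfm.prodMk_left] with ω hω
  rw [← eLpNorm_two_sq]
  gcongr
  refine (enorm_integral_le_lintegral_enorm _).trans ?_
  rw [← eLpNorm_one_eq_lintegral_enorm]
  exact eLpNorm_le_eLpNorm_of_exponent_le one_le_two hω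

theorem memLp_integral_comp (hb : Measurable fun p : T × X => b p.1 p.2)
    (hp : ∀ t, MeasurePreserving (b t) γ γ) {f : X → ℂ} (hf : MemLp f 2 γ) :
    MemLp (fun ω => ∫ t, f (b t ω) ∂θ) 2 γ :=
  ⟨aestronglyMeasurable_integral_comp hb hp hf.1,
    (eLpNorm_integral_comp_le hb hp hf.1).trans_lt hf.2⟩

/-- After exchanging integrals, for each `t` the factor `h` may be replaced by `h ∘ b t`, and `b t`
preserves `γ`. This yields the orthogonality of `f - Aₙ f` to fixed functions. -/
theorem integral_mul_integral_comp_of_invariant (hb : Measurable fun p : T × X => b p.1 p.2)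
    (hp : ∀ t, MeasurePreserving (b t) γ γ) {f h : X → ℂ} (hf : MemLp f 2 γ) (hh : MemLp h 2 γ)
    (hinv : ∀ t, (fun ω => h (b t ω)) =ᵐ[γ] h) :
    ∫ ω, h ω * ∫ t, f (b t ω) ∂θ ∂γ = ∫ ω, h ω * f ω ∂γ := by
  have hm := measurePreserving_uncurry_prod (θ := θ) hb hp
  have h1 : MemLp (fun p : X × T => f (b p.2 p.1)) 2 (γ.prod θ) := hf.comp_measurePreserving hm
  have h2 : MemLp (fun p : X × T => h p.1) 2 (γ.prod θ) :=
    hh.comp_measurePreserving measurePreserving_fst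
  have h3 : Integrable (fun p : X × T => h p.1 * f (b p.2 p.1)) (γ.prod θ) := h2.integrable_mul h1
  have h4 : ∀ t, ∫ ω, h ω * f (b t ω) ∂γ = ∫ ω, h ω * f ω ∂γ := by
    intro t
    have h5 : (fun ω => h ω * f (b t ω)) =ᵐ[γ] fun ω => h (b t ω) * f (b t ω) := by
      filter_upwards [hinv t] with ω hω
      rw [hω]
    rw [integral_congr_ae h5]
    have h6 := integral_map (μ := γ) (hp t).measurable.aemeasurable (f := fun x => h x * f x)
      (by rw [(hp t).map_eq]; exact hh.1.mul hf.1)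
    rw [(hp t).map_eq] at h6
    exact h6.symm
  simp_rw [← integral_const_mul]
  rw [integral_integral_swap h3]
  simp [h4]

/-- The action law fails on a null set depending on `t`; Fubini turns this into validity for almost
every `t` at almost every `ω`. Commutativity turns `t * s` into `s * t`, so left invariance
suffices. -/
theorem integral_comp_invariant {H : Type*} [CommGroup H] [MeasurableSpace H] [MeasurableMul H]
    {θ : Measure H} [IsProbabilityMeasure θ] [θ.IsMulLeftInvariant]
    [StandardBorelSpace X] {b : H → X → X} (hb : Measurable fun p : H × X => b p.1 p.2)
    (hmul : ∀ s t, ∀ᵐ ω ∂γ, b s (b t ω) = b (s * t) ω)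
    (hp : ∀ t, MeasurePreserving (b t) γ γ) (f : X → ℂ) (s : H) :
    (fun ω => ∫ t, f (b t (b s ω)) ∂θ) =ᵐ[γ] fun ω => ∫ t, f (b t ω) ∂θ := by
  have h1 : MeasurableSet {p : X × H | b p.2 (b s p.1) = b (s * p.2) p.1} := by
    refine measurableSet_eq_fun ?_ ?_
    · exact hb.comp (measurable_snd.prodMk ((hp s).measurable.comp measurable_fst))
    · exact hb.comp (((measurable_const_mul s).comp measurable_snd).prodMk measurable_fst)
  have h2 : ∀ᵐ p ∂γ.prod θ, b p.2 (b s p.1) = b (s * p.2) p.1 := by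
    have h3 : ∀ᵐ p ∂θ.prod γ, p.swap ∈ {p : X × H | b p.2 (b s p.1) = b (s * p.2) p.1} := by
      rw [Measure.ae_prod_iff_ae_ae (measurable_swap h1)]
      refine Eventually.of_forall fun t => ?_
      filter_upwards [hmul t s] with ω hω
      simpa [mul_comm s t] using hω
    have h4 := (Measure.measurePreserving_swap (μ := γ) (ν := θ)).quasiMeasurePreserving.ae h3
    simpa using h4
  filter_upwards [Measure.ae_ae_of_ae_prod h2] with ω hω
  rw [integral_congr_ae (hω.mono fun t ht => congrArg f ht),
    integral_mul_left_eq_self (fun t => f (b t ω))]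

end Averages

/-! ### Orthogonal projections onto a decreasing sequence of subspaces -/

/-- The complements `(U i)ᗮ` increase, so their projections converge to the projection onto the
closure `V` of their union, and `Vᗮ = ⨅ i, U i`. -/
theorem tendsto_starProjection_iInf {𝕜 E : Type*} [RCLike 𝕜] [NormedAddCommGroup E]
    [InnerProductSpace 𝕜 E] [CompleteSpace E] (U : ℕ → Submodule 𝕜 E)
    [∀ i, (U i).HasOrthogonalProjection] (hU : Antitone U) (x : E) :
    ∃ y ∈ ⨅ i, U i, x - y ∈ (⨅ i, U i)ᗮ ∧
      Tendsto (fun i => (U i).starProjection x) atTop (𝓝 y) := by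
  have h := Submodule.starProjection_tendsto_closure_iSup (fun i => (U i)ᗮ)
    (fun i j hij => Submodule.orthogonal_le (hU hij)) x
  set V := (⨆ i, (U i)ᗮ).topologicalClosure with hV
  have hVo : Vᗮ = ⨅ i, U i := by
    rw [hV, Submodule.orthogonal_closure, ← Submodule.iInf_orthogonal]
    simp
  refine ⟨x - V.starProjection x, ?_, ?_, ?_⟩
  · rw [← hVo]
    exact Submodule.sub_starProjection_mem_orthogonal x
  · rw [sub_sub_cancel, ← hVo]
    exact Submodule.le_orthogonal_orthogonal V (Submodule.starProjection_apply_mem V x)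
  · refine (tendsto_const_nhds.sub h).congr fun i => ?_
    rw [Submodule.starProjection_orthogonal_val, sub_sub_cancel]

/-! ### Functions fixed by a set of measure preserving maps -/

section Fixed

variable {G X : Type*} [MeasurableSpace X] {γ : Measure X} {a : G → X → X}

/-- The space of all square integrable functions invariant, modulo null sets, under all the measure
preserving maps `a g`, `g ∈ S`. -/
noncomputable def fixedSubmodule (hp : ∀ g, MeasurePreserving (a g) γ γ) (S : Set G) :
    Submodule ℂ (Lp ℂ 2 γ) :=
  ⨅ g ∈ S, LinearMap.eqLocus (Lp.compMeasurePreservingₗ ℂ (a g) (hp g)) LinearMap.id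

theorem mem_fixedSubmodule (hp : ∀ g, MeasurePreserving (a g) γ γ) {S : Set G} {h : Lp ℂ 2 γ} :
    h ∈ fixedSubmodule hp S ↔ ∀ g ∈ S, (fun ω => h (a g ω)) =ᵐ[γ] h := by
  simp only [fixedSubmodule, Submodule.mem_iInf, LinearMap.mem_eqLocus, LinearMap.id_apply]
  refine forall₂_congr fun g _ => ?_
  have e := Lp.coeFn_compMeasurePreserving h (hp g)
  constructor
  · intro hg
    have hg' : Lp.compMeasurePreserving (a g) (hp g) h = h := hg
    rw [hg'] at e
    exact e.symm
  · intro hg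
    exact Lp.ext (e.trans hg)

theorem isClosed_fixedSubmodule (hp : ∀ g, MeasurePreserving (a g) γ γ) (S : Set G) :
    IsClosed (fixedSubmodule hp S : Set (Lp ℂ 2 γ)) := by
  simp only [fixedSubmodule, Submodule.coe_iInf]
  refine isClosed_iInter fun g => isClosed_iInter fun _ => ?_
  exact isClosed_eq (Lp.isometry_compMeasurePreserving (hp g)).continuous continuous_id

instance (hp : ∀ g, MeasurePreserving (a g) γ γ) (S : Set G) :
    (fixedSubmodule hp S).HasOrthogonalProjection :=
  haveI := (isClosed_fixedSubmodule hp S).completeSpace_coe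
  inferInstance

theorem fixedSubmodule_antitone (hp : ∀ g, MeasurePreserving (a g) γ γ) :
    Antitone (fixedSubmodule hp) :=
  fun _ _ h => biInf_mono h

/-- Averaging over a compact commutative group is the orthogonal projection onto the functions
fixed by that group. -/
theorem starProjection_fixedSubmodule_range [StandardBorelSpace X] [IsProbabilityMeasure γ]
    (hp : ∀ g, MeasurePreserving (a g) γ γ)
    {H : Type*} [CommGroup H] [MeasurableSpace H] [MeasurableMul H] {θ : Measure H}
    [IsProbabilityMeasure θ] [θ.IsMulLeftInvariant] (φ : H → G)
    (hb : Measurable fun p : H × X => a (φ p.1) p.2)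
    (hmul : ∀ s t, ∀ᵐ ω ∂γ, a (φ s) (a (φ t) ω) = a (φ (s * t)) ω)
    {f : X → ℂ} (hf : MemLp f 2 γ) :
    (fixedSubmodule hp (range φ)).starProjection (hf.toLp f) =
      (memLp_integral_comp (θ := θ) (b := fun t => a (φ t)) hb (fun t => hp (φ t)) hf).toLp _ := by
  have hA := memLp_integral_comp (θ := θ) (b := fun t => a (φ t)) hb (fun t => hp (φ t)) hf
  refine Submodule.eq_starProjection_of_mem_orthogonal (K := fixedSubmodule hp (range φ)) ?_ ?_
  · rw [mem_fixedSubmodule]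
    rintro _ ⟨s, rfl⟩
    have e := hA.coeFn_toLp
    have e' := (hp (φ s)).quasiMeasurePreserving.ae e
    filter_upwards [e, e', integral_comp_invariant (θ := θ) (b := fun t => a (φ t)) hb hmul
      (fun t => hp (φ t)) f s] with ω h1 h2 h3
    rw [h1, h2, h3]
  · rw [Submodule.mem_orthogonal]
    intro u hu
    rw [mem_fixedSubmodule] at hu
    rw [inner_sub_right, sub_eq_zero, L2.inner_def, L2.inner_def]
    -- The pairing lemma is bilinear, so it is applied to the conjugate of `u`, which is fixed as
    -- well.
    have hu2 : MemLp (fun ω => (starRingEnd ℂ) (u ω)) 2 γ := (Lp.memLp u).star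
    have key := integral_mul_integral_comp_of_invariant (θ := θ) (b := fun t => a (φ t)) hb
      (fun t => hp (φ t)) hf hu2 (fun t => by
        filter_upwards [hu _ (mem_range_self t)] with ω hω
        rw [hω])
    have e1 : ∫ ω, inner ℂ (u ω) (hf.toLp f ω) ∂γ = ∫ ω, (starRingEnd ℂ) (u ω) * f ω ∂γ := by
      refine integral_congr_ae ?_
      filter_upwards [hf.coeFn_toLp] with ω hω
      rw [hω, RCLike.inner_apply, mul_comm]
    have e2 : ∫ ω, inner ℂ (u ω) (hA.toLp _ ω) ∂γ =
        ∫ ω, (starRingEnd ℂ) (u ω) * ∫ t, f (a (φ t) ω) ∂θ ∂γ := by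
      refine integral_congr_ae ?_
      filter_upwards [hA.coeFn_toLp] with ω hω
      rw [hω, RCLike.inner_apply, mul_comm]
    rw [e1, e2, key]

end Fixed

/-! ### Density of the step functions in `L⁰(λ, 𝕋)` -/

instance : IsProbabilityMeasure cantorMeasure := by
  unfold cantorMeasure
  infer_instance

theorem exists_stepFun_eq_of_dependsOn {n : ℕ} {f : (ℕ → Bool) → Circle}
    (hf : DependsOn f (Iic n)) : ∃ z, f = stepFun (n + 1) z := by
  -- `Iic n` has `n + 1` elements; the padding value `false` is irrelevant.
  refine ⟨fun s => f fun i => if h : i < n + 1 then s ⟨i, h⟩ else false, ?_⟩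
  funext α
  refine hf fun i hi => ?_
  have hi' : i < n + 1 := Nat.lt_succ_of_le hi
  simp [hi']

theorem iSup_piLE_nat_eq_pi :
    ⨆ n, (Filtration.piLE (X := fun _ : ℕ => Bool) : Filtration ℕ _) n = MeasurableSpace.pi := by
  refine le_antisymm (iSup_le fun n => Filtration.le _ n) ?_
  refine iSup_le fun i => le_trans ?_ (le_iSup _ i)
  rw [← measurable_iff_comap_le]
  have h : Measurable[(Filtration.piLE (X := fun _ : ℕ => Bool) : Filtration ℕ _) i]
      (Preorder.restrictLe (π := fun _ : ℕ => Bool) i) := comap_measurable _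
  exact (measurable_pi_apply (⟨i, mem_Iic.2 le_rfl⟩ : Iic i)).comp h

/-- Every element of `L⁰(λ, 𝕋)` is an almost everywhere limit of step functions. -/
theorem LZero.exists_tendsto_stepFun (φ : LZero) :
    ∃ z : ∀ n : ℕ, (Fin (n + 1) → Bool) → Circle,
      ∀ᵐ α ∂cantorMeasure, Tendsto (fun n => stepFun (n + 1) (z n) α) atTop (𝓝 (φ.toFun α)) := by
  have hφ : Measurable φ.toFun := (AEEqFun.stronglyMeasurable φ).measurable
  set F : Filtration ℕ (MeasurableSpace.pi : MeasurableSpace (ℕ → Bool)) :=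
    Filtration.piLE (X := fun _ : ℕ => Bool)
  -- Conditional expectation needs a linear target: the bounded argument is approximated by Lévy's
  -- upward theorem, and `Circle.exp` carries the limit back to the circle.
  set g : (ℕ → Bool) → ℝ := fun α => Complex.arg (φ.toFun α : ℂ)
  have hc : Continuous Circle.coeHom := continuous_subtype_val
  have hcoe : Measurable Circle.coeHom := hc.measurable
  have hgm : Measurable g := Complex.measurable_arg.comp (hcoe.comp hφ)
  have hgi : Integrable g cantorMeasure :=
    Integrable.of_bound hgm.aestronglyMeasurable Real.pi
      (Eventually.of_forall fun α => Complex.abs_arg_le_pi _)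
  have hlim := hgi.tendsto_ae_condExp (ℱ := F) (by
    rw [iSup_piLE_nat_eq_pi]
    exact hgm.stronglyMeasurable)
  have hdep : ∀ n, ∃ z, (fun α => Circle.exp ((cantorMeasure[g | F n]) α)) =
      stepFun (n + 1) z := by
    intro n
    -- Measurability for `F n` gives dependence on the coordinates up to `n` at every point, not
    -- merely almost everywhere.
    have h : DependsOn (cantorMeasure[g | F n]) (Iic n) :=
      stronglyMeasurable_condExp.dependsOn_of_piLE
    exact exists_stepFun_eq_of_dependsOn fun α β hαβ => congrArg Circle.exp (h hαβ)
  choose z hz using hdep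
  refine ⟨z, ?_⟩
  filter_upwards [hlim] with α hα
  have h1 : Circle.exp (g α) = φ.toFun α := Circle.exp_arg _
  rw [← h1]
  refine ((Circle.exp.continuous.tendsto _).comp hα).congr fun n => ?_
  exact congrFun (hz n) α

theorem dense_iUnion_stepGroup : Dense (⋃ n, (stepGroup n : Set LZero)) := by
  rw [dense_iff_inter_open]
  rintro U hU ⟨φ, hφ⟩
  obtain ⟨ε, hε, h⟩ := hU φ hφ
  obtain ⟨z, hz⟩ := φ.exists_tendsto_stepFun
  have hm := tendstoInMeasure_of_tendsto_ae (fun n => stepFun_measurable (n + 1) (z n)) hz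
  have h1 := hm (ENNReal.ofReal ε) (ENNReal.ofReal_pos.2 hε)
  obtain ⟨n, hn⟩ := (h1.eventually (ge_mem_nhds (ENNReal.ofReal_pos.2 hε))).exists
  refine ⟨stepHom (n + 1) (z n), h _ (le_trans (measure_mono_ae ?_) hn),
    mem_iUnion.2 ⟨n + 1, z n, rfl⟩⟩
  have h2 : ∀ᵐ α ∂cantorMeasure, (stepHom (n + 1) (z n)).toFun α = stepFun (n + 1) (z n) α :=
    AEEqFun.coeFn_mk _ (stepFun_measurable (n + 1) (z n))
  filter_upwards [h2] with α hα hd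
  have hd' : ε ≤ dist (φ.toFun α) ((stepHom (n + 1) (z n)).toFun α) := hd
  rw [hα, dist_comm] at hd'
  show ENNReal.ofReal ε ≤ edist _ _
  rw [edist_dist]
  exact ENNReal.ofReal_le_ofReal hd'

theorem stepGroup_mono : Monotone fun n => (stepGroup n : Set LZero) := by
  rintro n m h _ ⟨z, rfl⟩
  exact ⟨fun s => z fun i => s (Fin.castLE h i), rfl⟩

/-! ### Elementary properties of `Aut(γ)` -/

section Aut

variable {X : Type*} [MeasurableSpace X] {γ : Measure X}

theorem AutGroup.rep_mk_ae (e : MPGroup γ) :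
    ((AutGroup.rep (QuotientGroup.mk e : MPGroup γ ⧸ aeTrivial γ)).1 : X → X) =ᵐ[γ] e.1 := by
  set r : MPGroup γ := AutGroup.rep (QuotientGroup.mk e : MPGroup γ ⧸ aeTrivial γ) with hr
  have h : (QuotientGroup.mk r : MPGroup γ ⧸ aeTrivial γ) = QuotientGroup.mk e :=
    Quotient.out_eq (QuotientGroup.mk e : MPGroup γ ⧸ aeTrivial γ)
  have h' : ∀ᵐ x ∂γ, (r.1⁻¹ * e.1) x = x := QuotientGroup.eq.1 h
  filter_upwards [h'] with x hx
  rw [Equiv.Perm.mul_apply, Equiv.Perm.inv_eq_iff_eq] at hx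
  exact hx.symm

theorem AutGroup.mk_rep (T : AutGroup γ) :
    (QuotientGroup.mk T.rep : MPGroup γ ⧸ aeTrivial γ) = T :=
  Quotient.out_eq T

theorem AutGroup.rep_one_ae : ((1 : AutGroup γ).rep.1 : X → X) =ᵐ[γ] id :=
  AutGroup.rep_mk_ae 1

theorem AutGroup.rep_mul_ae (S T : AutGroup γ) :
    ((S * T).rep.1 : X → X) =ᵐ[γ] fun x => S.rep.1 (T.rep.1 x) := by
  have h : S * T = (QuotientGroup.mk (S.rep * T.rep) : MPGroup γ ⧸ aeTrivial γ) := by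
    conv_lhs => rw [← S.mk_rep, ← T.mk_rep]
    rfl
  rw [h]
  exact AutGroup.rep_mk_ae (S.rep * T.rep)

theorem AutGroup.measurePreserving_rep (T : AutGroup γ) :
    MeasurePreserving (T.rep.1 : X → X) γ γ := T.rep.2.1

theorem AutGroup.measurable_graph (T : AutGroup γ) : Measurable fun x => (x, T.rep.1 x) :=
  measurable_id.prodMk T.measurePreserving_rep.measurable

theorem AutGroup.continuous_image (A : MeasuredSets γ) :
    Continuous fun T : AutGroup γ => T.image A :=
  continuous_iff_le_induced.2 (iInf_le _ A)

theorem AutGroup.preimage_image (T : AutGroup γ) (A : MeasuredSets γ) :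
    T.rep.1 ⁻¹' (T.image A : Set X) = A :=
  preimage_image_eq _ T.rep.1.injective

/-- Pulling the hypothesis back along the inverse map passes from preimages, natural for functions,
to images, which define the topology and ergodicity. -/
theorem AutGroup.image_ae_eq (T : AutGroup γ) (A : MeasuredSets γ)
    (h : T.rep.1 ⁻¹' (A : Set X) =ᵐ[γ] (A : Set X)) : (T.image A : Set X) =ᵐ[γ] (A : Set X) := by
  have hq : MeasurePreserving ((T.rep⁻¹ : MPGroup γ).1 : X → X) γ γ := (T.rep⁻¹).2.1
  have h1 := hq.quasiMeasurePreserving.preimage_ae_eq h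
  have h2 : ((T.rep⁻¹ : MPGroup γ).1 : X → X) ⁻¹' (T.rep.1 ⁻¹' (A : Set X)) = A := by
    ext x
    simp
  have h3 : ((T.rep⁻¹ : MPGroup γ).1 : X → X) ⁻¹' (A : Set X) = T.image A :=
    (Equiv.image_eq_preimage_symm T.rep.1 (A : Set X)).symm
  rw [h2, h3] at h1
  exact h1.symm

theorem MeasuredSets.edist_eq_zero_iff {s t : MeasuredSets γ} :
    edist s t = 0 ↔ (s : Set X) =ᵐ[γ] (t : Set X) := by
  rw [MeasuredSets.edist_def, measure_symmDiff_eq_zero_iff]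

theorem MeasuredSets.continuous_measure_inter (B : Set X) :
    Continuous fun s : MeasuredSets γ => γ ((s : Set X) ∩ B) := by
  refine continuous_of_le_add_edist 1 ENNReal.one_ne_top fun s t => ?_
  rw [one_mul, MeasuredSets.edist_def]
  refine (measure_mono ?_).trans (measure_union_le _ _)
  rintro x ⟨hs, hB⟩
  by_cases ht : x ∈ (t : Set X)
  · exact Or.inl ⟨ht, hB⟩
  · exact Or.inr (Or.inl ⟨hs, ht⟩)

end Aut

/-! ### Near-actions -/

section NearAction

variable {G : Type*} [Group G] [TopologicalSpace G] {X : Type*} [MeasurableSpace X]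
  {γ : Measure X}

/-- An ergodic boolean action has no nonconstant measurable functions invariant under a dense set
of group elements. -/
theorem BooleanAction.IsErgodic.ae_eq_const [IsProbabilityMeasure γ] {ζ : BooleanAction G γ}
    (hζ : ζ.IsErgodic) {S : Set G} (hS : Dense S) {Y : Type*} [MeasurableSpace Y] [Nonempty Y]
    [MeasurableSpace.CountablySeparated Y] {f : X → Y} (hf : Measurable f)
    (h : ∀ g ∈ S, (fun ω => f ((ζ g).rep.1 ω)) =ᵐ[γ] f) : ∃ c, f =ᵐ[γ] fun _ => c := by
  refine exists_eventuallyEq_const_of_forall_separating MeasurableSet fun U hU => ?_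
  let B : MeasuredSets γ := ⟨f ⁻¹' U, hf hU⟩
  -- Weak continuity closes up the stabilizer of `B`, so invariance under the dense set `S` extends
  -- to all of `G`.
  have hcl : IsClosed {g : G | edist ((ζ g).image B) B = 0} := by
    have hc : Continuous fun g : G => edist ((ζ g).image B) B :=
      ((AutGroup.continuous_image B).comp ζ.continuous_toFun).edist continuous_const
    exact isClosed_singleton.preimage hc
  have hsub : S ⊆ {g : G | edist ((ζ g).image B) B = 0} := by
    intro g hg
    refine MeasuredSets.edist_eq_zero_iff.2 (AutGroup.image_ae_eq _ _ ?_)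
    filter_upwards [h g hg] with ω hω
    show (f ((ζ g).rep.1 ω) ∈ U) = (f ω ∈ U)
    rw [hω]
  have hall : ∀ g : G, ((ζ g).image B : Set X) =ᵐ[γ] (B : Set X) := fun g =>
    MeasuredSets.edist_eq_zero_iff.1 (hcl.closure_subset_iff.2 hsub (hS g))
  rcases hζ B hall with h1 | h0
  · exact Or.inl ((mem_ae_iff_prob_eq_one (hf hU)).2 h1)
  · exact Or.inr (measure_eq_zero_iff_ae_notMem.1 h0)

variable [MeasurableSpace G] [BorelSpace G]

/-- The Markov kernel which maps `g` to the measure carried by the graph of `ζ g`. -/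
noncomputable def BooleanAction.graphKernel [IsProbabilityMeasure γ] (ζ : BooleanAction G γ) :
    Kernel G (X × X) where
  toFun g := γ.map fun x => (x, (ζ g).rep.1 x)
  measurable' := by
    have : ∀ g : G, IsProbabilityMeasure (γ.map fun x => (x, (ζ g).rep.1 x)) := fun g =>
      Measure.isProbabilityMeasure_map (ζ g).measurable_graph.aemeasurable
    refine Measurable.measure_of_isPiSystem_of_isProbabilityMeasure generateFrom_prod.symm
      isPiSystem_prod ?_
    rintro _ ⟨A, hA, B, hB, rfl⟩
    let A' : MeasuredSets γ := ⟨A, hA⟩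
    -- On rectangles the graph measure is a continuous function of `g`; rectangles form a generating
    -- π-system.
    have e : ∀ g : G, (γ.map fun x => (x, (ζ g).rep.1 x)) (A ×ˢ B) =
        γ (((ζ g).image A' : Set X) ∩ B) := by
      intro g
      have h1 := (ζ g).measurePreserving_rep.measure_preimage
        (((ζ g).image A').2.inter hB).nullMeasurableSet
      have h2 : (ζ g).rep.1 ⁻¹' ((ζ g).image A').1 = A := (ζ g).preimage_image A'
      rw [preimage_inter, h2] at h1
      rw [Measure.map_apply (ζ g).measurable_graph (hA.prod hB)]
      exact h1
    simp_rw [e]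
    exact ((MeasuredSets.continuous_measure_inter B).comp
      ((AutGroup.continuous_image _).comp ζ.continuous_toFun)).measurable

theorem BooleanAction.graphKernel_apply [IsProbabilityMeasure γ] (ζ : BooleanAction G γ) (g : G) :
    ζ.graphKernel g = γ.map fun x => (x, (ζ g).rep.1 x) := rfl

instance [IsProbabilityMeasure γ] (ζ : BooleanAction G γ) : IsMarkovKernel ζ.graphKernel :=
  ⟨fun g => Measure.isProbabilityMeasure_map
    (ζ g).measurable_graph.aemeasurable⟩

/-- Disintegrating the graphs of the automorphisms `ζ g` gives a jointly measurable version
of the boolean action `ζ`. -/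
theorem BooleanAction.exists_measurable_version [StandardBorelSpace X] [IsProbabilityMeasure γ]
    (ζ : BooleanAction G γ) :
    ∃ a : G → X → X, Measurable (fun p : G × X => a p.1 p.2) ∧
      ∀ g, a g =ᵐ[γ] ((ζ g).rep.1 : X → X) := by
  have : Nonempty X := nonempty_of_isProbabilityMeasure γ
  have he := measurableEmbedding_embeddingReal X
  set κ := ζ.graphKernel.condKernel
  have hdis : ζ.graphKernel.fst ⊗ₖ κ = ζ.graphKernel := ζ.graphKernel.disintegrate κ
  have hfst : ∀ g, ζ.graphKernel.fst g = γ := by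
    intro g
    rw [Kernel.fst_apply, ζ.graphKernel_apply, Measure.map_map measurable_fst
      (ζ g).measurable_graph]
    exact Measure.map_id
  -- Integrating a real embedding against a Dirac measure gives the code of its atom, which `invFun`
  -- decodes; elsewhere the value is immaterial.
  refine ⟨fun g x => he.invFun (∫ y, embeddingReal X y ∂κ (g, x)), ?_, fun g => ?_⟩
  · exact he.measurable_invFun.comp
      (he.measurable.stronglyMeasurable.integral_kernel (κ := κ)).measurable
  · have hT := (ζ g).measurePreserving_rep.measurable
    have hset : MeasurableSet {p : X × X | p.2 = (ζ g).rep.1 p.1} :=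
      measurableSet_eq_fun measurable_snd (hT.comp measurable_fst)
    have h1 : ∀ᵐ p ∂ζ.graphKernel g, p.2 = (ζ g).rep.1 p.1 := by
      rw [ζ.graphKernel_apply, ae_map_iff (ζ g).measurable_graph.aemeasurable hset]
      exact Eventually.of_forall fun x => rfl
    rw [← hdis] at h1
    have h2 := Kernel.ae_ae_of_ae_compProd h1
    rw [hfst] at h2
    filter_upwards [h2] with x hx
    rw [integral_congr_ae (g := fun _ => embeddingReal X ((ζ g).rep.1 x))
      (hx.mono fun y hy => congrArg _ hy)]
    simp only [integral_const, probReal_univ, one_smul]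
    exact he.leftInverse_invFun _

theorem BooleanAction.exists_isRealizedBy [StandardBorelSpace X] [IsProbabilityMeasure γ]
    (ζ : BooleanAction G γ) : ∃ a : G → X → X, ζ.IsRealizedBy a := by
  obtain ⟨a, ha, h⟩ := ζ.exists_measurable_version
  have hp : ∀ g, MeasurePreserving (a g) γ γ := fun g =>
    ⟨ha.comp measurable_prodMk_left,
      (Measure.map_congr (h g)).trans (ζ g).measurePreserving_rep.map_eq⟩
  refine ⟨a, ⟨?_, ?_, fun g k => ?_, hp⟩, h⟩
  · rw [← BorelSpace.measurable_eq (α := G)]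
    exact ha
  · have h1 := h 1
    rw [map_one] at h1
    exact h1.trans AutGroup.rep_one_ae
  · have h1 := h (g * k)
    rw [map_mul] at h1
    filter_upwards [h1, AutGroup.rep_mul_ae (ζ g) (ζ k), h k,
      (hp k).quasiMeasurePreserving.ae (h g)] with ω e1 e2 e3 e4
    rw [e1, e2, e4, e3]

end NearAction

/-! ### Averages over the groups `𝕊ₙ` -/

/-- Transfers the average to the torus, where translation invariance of Haar measure is at hand. -/
theorem averaging_eq_integral_haarMeasure {X : Type*} [MeasurableSpace X]
    (a : LZero → X → X) (ha : Measurable fun p : LZero × X => a p.1 p.2) (n : ℕ) {f : X → ℂ}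
    (hf : StronglyMeasurable f) (ω : X) :
    averaging a n f ω = ∫ z, f (a (stepHom n z) ω)
      ∂(Measure.haarMeasure (⊤ : TopologicalSpace.PositiveCompacts
        ((Fin n → Bool) → Circle))) := by
  have hm : Measurable fun t : stepGroup n => a (t : LZero) ω :=
    ha.comp (measurable_subtype_coe.prodMk measurable_const)
  exact integral_map (toStepGroup_measurable n).aemeasurable
    (hf.comp_measurable hm).aestronglyMeasurable

theorem tendsto_averaging_of_isErgodic {X : Type*} [MeasurableSpace X] [StandardBorelSpace X]
    {γ : Measure X} [IsProbabilityMeasure γ] {ζ : BooleanAction LZero γ} {a : LZero → X → X}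
    (h : ζ.IsRealizedBy a) (hζ : ζ.IsErgodic) {f : X → ℂ} (hf : MemLp f 2 γ) :
    Tendsto (fun n : ℕ => eLpNorm (fun ω => averaging a n f ω - ∫ x, f x ∂γ) 2 γ)
      atTop (𝓝 0) := by
  have ha : Measurable fun p : LZero × X => a p.1 p.2 := h.1.measurable
  have hp := h.1.measurePreserving
  -- The transfer to the torus asks for a strongly measurable function; `hfa` shows that the
  -- averages change only on null sets.
  obtain ⟨g, hg, hfg⟩ := hf.1
  have hg2 : MemLp g 2 γ := (memLp_congr_ae hfg).1 hf
  have hb : ∀ n, Measurable fun p : ((Fin n → Bool) → Circle) × X => a (stepHom n p.1) p.2 :=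
    fun n => ha.comp (((stepHom_continuous n).measurable.comp measurable_fst).prodMk
      measurable_snd)
  have hbS : ∀ n, Measurable fun p : stepGroup n × X => a (p.1 : LZero) p.2 :=
    fun n => ha.comp ((measurable_subtype_coe.comp measurable_fst).prodMk measurable_snd)
  have hprob : ∀ n, IsProbabilityMeasure (Measure.haarMeasure
      (⊤ : TopologicalSpace.PositiveCompacts ((Fin n → Bool) → Circle))) :=
    fun n => ⟨Measure.haarMeasure_self⟩
  have hfa : ∀ n, averaging a n f =ᵐ[γ] averaging a n g := fun n =>
    integral_comp_congr_ae (b := fun t : stepGroup n => a (t : LZero)) (hbS n)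
      (fun t => hp t) hfg
  have hA : ∀ n, MemLp (averaging a n g) 2 γ := fun n =>
    memLp_integral_comp (b := fun t : stepGroup n => a (t : LZero)) (hbS n) (fun t => hp t) hg2
  let U : ℕ → Submodule ℂ (Lp ℂ 2 γ) := fun n => fixedSubmodule hp (stepGroup n : Set LZero)
  have hproj : ∀ n, (U n).starProjection (hg2.toLp g) = (hA n).toLp _ := by
    intro n
    have e : averaging a n g = fun ω => ∫ z, g (a (stepHom n z) ω)
        ∂(Measure.haarMeasure (⊤ : TopologicalSpace.PositiveCompacts
          ((Fin n → Bool) → Circle))) :=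
      funext fun ω => averaging_eq_integral_haarMeasure a ha n hg ω
    have := starProjection_fixedSubmodule_range hp
      (θ := Measure.haarMeasure (⊤ : TopologicalSpace.PositiveCompacts
        ((Fin n → Bool) → Circle))) (stepHom n) (hb n)
      (fun s t => by rw [map_mul]; exact h.1.mul_ae _ _) hg2
    simp_rw [← e] at this
    exact this
  obtain ⟨y, hy, hyo, hlim⟩ := tendsto_starProjection_iInf U
    (fun n m hnm => fixedSubmodule_antitone hp (stepGroup_mono hnm)) (hg2.toLp g)
  obtain ⟨c, hc⟩ : ∃ c, y =ᵐ[γ] fun _ => c := by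
    refine hζ.ae_eq_const dense_iUnion_stepGroup (Lp.stronglyMeasurable y).measurable ?_
    intro t ht
    obtain ⟨n, hn⟩ := mem_iUnion.1 ht
    filter_upwards [(mem_fixedSubmodule hp).1 (Submodule.mem_iInf _ |>.1 hy n) t hn, h.2 t]
      with ω h1 h2
    rw [← h2, h1]
  have h1 : MemLp (fun _ : X => (1 : ℂ)) 2 γ := memLp_const 1
  -- Constants are fixed, so `hyo` gives equal integrals for `g` and the limit `y`.
  have hone : h1.toLp _ ∈ ⨅ n, U n := by
    refine Submodule.mem_iInf _ |>.2 fun n => (mem_fixedSubmodule hp).2 fun t _ => ?_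
    have e := h1.coeFn_toLp
    filter_upwards [e, (hp t).quasiMeasurePreserving.ae e] with ω e1 e2
    rw [e1, e2]
  have hcf : c = ∫ x, f x ∂γ := by
    have h0 := Submodule.inner_right_of_mem_orthogonal hone hyo
    rw [inner_sub_right, sub_eq_zero, L2.inner_def, L2.inner_def] at h0
    have e1 : ∫ ω, inner ℂ (h1.toLp _ ω) (hg2.toLp g ω) ∂γ = ∫ x, f x ∂γ := by
      refine integral_congr_ae ?_
      filter_upwards [h1.coeFn_toLp, hg2.coeFn_toLp, hfg] with ω w1 w2 w3
      rw [w1, w2, w3]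
      simp
    have e2 : ∫ ω, inner ℂ (h1.toLp _ ω) (y ω) ∂γ = ∫ _, c ∂γ := by
      refine integral_congr_ae ?_
      filter_upwards [h1.coeFn_toLp, hc] with ω w1 w2
      rw [w1, w2]
      simp
    rw [e1, e2] at h0
    simpa using h0.symm
  rw [tendsto_iff_edist_tendsto_0] at hlim
  refine hlim.congr fun n => ?_
  rw [hproj n, Lp.edist_def]
  refine eLpNorm_congr_ae ?_
  filter_upwards [(hA n).coeFn_toLp, hc, hfa n] with ω w1 w2 w3
  rw [Pi.sub_apply, w1, w2, w3, hcf]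

theorem theorem1p2 {X : Type*} [MeasurableSpace X] [StandardBorelSpace X]
    (γ : Measure X) [IsProbabilityMeasure γ] [NullSingletonClass γ]
    (ζ : BooleanAction LZero γ) :
    (∃ a : LZero → X → X, ζ.IsRealizedBy a) ∧
    ∀ a : LZero → X → X, ζ.IsRealizedBy a → ∀ f : X → ℂ, MemLp f 2 γ →
      (∀ n : ℕ,
        (∀ᵐ ω ∂γ, Integrable (fun t : stepGroup n => f (a (t : LZero) ω)) (stepHaar n)) ∧
        MemLp (averaging a n f) 2 γ ∧
        eLpNorm (averaging a n f) 2 γ ≤ eLpNorm f 2 γ) ∧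
      (ζ.IsErgodic →
        Tendsto (fun n : ℕ => eLpNorm (fun ω => averaging a n f ω - ∫ x, f x ∂γ) 2 γ)
          atTop (𝓝 0)) := by
  refine ⟨ζ.exists_isRealizedBy, fun a h f hf => ⟨fun n => ?_, fun hζ =>
    tendsto_averaging_of_isErgodic h hζ hf⟩⟩
  have ha : Measurable fun p : LZero × X => a p.1 p.2 := h.1.measurable
  have hb : Measurable fun p : stepGroup n × X => a (p.1 : LZero) p.2 :=
    ha.comp ((measurable_subtype_coe.comp measurable_fst).prodMk measurable_snd)
  have hp : ∀ t : stepGroup n, MeasurePreserving (a (t : LZero)) γ γ :=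
    fun t => h.1.measurePreserving t
  exact ⟨ae_integrable_comp (b := fun t : stepGroup n => a (t : LZero)) hb hp
      (hf.integrable one_le_two),
    memLp_integral_comp (b := fun t : stepGroup n => a (t : LZero)) hb hp hf,
    eLpNorm_integral_comp_le (b := fun t : stepGroup n => a (t : LZero)) hb hp hf.1⟩
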